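/- A commutative semi-ring of characteristic $1$ is a triple $(\mathcal R,\oplus,+)$ where $(\mathcal R,+)$ is a commutative monoid with identity $0$, the law $\oplus$ is associative, commutative and idempotent ($X\oplus X=X$; no neutral element is required for $\oplus$), and $X+(Y\oplus Z)=(X+Y)\oplus(X+Z)$ for all $X,Y,Z$. It is cancellative if $X+Y=X+Z$ implies $Y=Z$, and perfect if for every integer $n\ge 1$ the map $\theta_n: X\mapsto nX$ is surjective on $\mathcal R$. A homomorphism of such semi-rings is a map preserving $\oplus$, $+$ and $0$. Let $(\mathcal R,\oplus,+)$ be a perfect cancellative commutative semi-ring of characteristic $1$. The maps $\theta_n$ are then bijective, and one writes $tX=\theta_a(\theta_b^{-1}(X))$ for $t=a/b\in\mathbb Q^{+}=\mathbb Q\cap[0,\infty)$ (so $0X=0$). Let $\mathcal F=\{X-Y : X,Y\in\mathcal R\}$ be the semi-field of fractions of $\mathcal R$, that is, the group of differences of $(\mathcal R,+)$ with $(A-B)\oplus(C-D)=\big((A+D)\oplus(C+B)\big)-(B+D)$, ordered by $Z\le W$ iff $Z\oplus W=W$. Let $E\in\mathcal R$ be such that: 1. for every $X\in\mathcal R$ there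 is $t\in\mathbb Q^+$ with $-tE\le X\le tE$ in $\mathcal F$; 2. for all $X,Y\in\mathcal R$, if $r(X-Y):=\inf\{t\in\mathbb Q^+ : -tE\le X-Y\le tE\}$ equals $0$, then $X=Y$. Let $S_E(\mathcal R)$ be the set of semi-ring homomorphisms $\phi:(\mathcal R,\oplus,+)\to(\mathbb R,\max,+)$ with $\phi(E)=1$, endowed with the weakest topology making all the maps $\phi\mapsto\phi(X)$, $X\in\mathcal R$, continuous. Then $$ j:(\mathcal R,\oplus,+)\to\big(C^0(S_E(\mathcal R),\mathbb R),\max,+\big),\qquad j_X(\phi)=\phi(X), $$ is a well-defined injective homomorphism of semi-rings. -/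

import Mathlib

/-- A commutative semi-ring of characteristic `1`: a commutative monoid `(R, +, 0)` together with an
associative, commutative and idempotent law `⊕` over which `+` distributes. No neutral element for
`⊕` (no `-∞`) is required. -/
class CharOneSemiring (R : Type*) [AddCommMonoid R] where
  /-- The law `⊕`. -/
  oplus : R → R → R
  oplus_assoc : ∀ X Y Z : R, oplus (oplus X Y) Z = oplus X (oplus Y Z)
  oplus_comm : ∀ X Y : R, oplus X Y = oplus Y X
  oplus_idem : ∀ X : R, oplus X X = X
  add_oplus : ∀ X Y Z : R, X + oplus Y Z = oplus (X + Y) (X + Z)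

namespace CharOneSemiring

open Algebra

/-- Perfectness: for every integer `n ≥ 1` the map `X ↦ n X` is surjective. -/
class IsPerfect (R : Type*) [AddCommMonoid R] : Prop where
  surjective_nsmul : ∀ n : ℕ, 0 < n → Function.Surjective (fun X : R => n • X)

/-- The canonical partial order: `X ≤ Y` iff `X ⊕ Y = Y`. -/
def Le {R : Type*} [AddCommMonoid R] [CharOneSemiring R] (X Y : R) : Prop :=
  oplus X Y = Y

/-- Homomorphisms of semi-rings of characteristic `1`. -/
structure Hom (R S : Type*) [AddCommMonoid R] [CharOneSemiring R]
    [AddCommMonoid S] [CharOneSemiring S] extends R →+ S where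
  map_oplus : ∀ X Y : R, toFun (oplus X Y) = oplus (toFun X) (toFun Y)

instance {R S : Type*} [AddCommMonoid R] [CharOneSemiring R]
    [AddCommMonoid S] [CharOneSemiring S] : CoeFun (Hom R S) (fun _ => R → S) where
  coe f := f.toFun

/-- The semi-field `(ℝ, max, +)`. -/
noncomputable instance : CharOneSemiring ℝ where
  oplus x y := max x y
  oplus_assoc := max_assoc
  oplus_comm := max_comm
  oplus_idem := max_self
  add_oplus x y z := (max_add_add_left x y z).symm

/-- The semi-field `(C⁰(K, ℝ), max, +)`, with the pointwise maximum. -/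
noncomputable instance {K : Type*} [TopologicalSpace K] : CharOneSemiring C(K, ℝ) where
  oplus f g := ⟨fun x => max (f x) (g x), f.continuous.max g.continuous⟩
  oplus_assoc f g h := ContinuousMap.ext fun x => max_assoc (f x) (g x) (h x)
  oplus_comm f g := ContinuousMap.ext fun x => max_comm (f x) (g x)
  oplus_idem f := ContinuousMap.ext fun x => max_self (f x)
  add_oplus f g h := ContinuousMap.ext fun x => (max_add_add_left (f x) (g x) (h x)).symm

section Fractions

variable {R : Type*} [AddCommMonoid R] [CharOneSemiring R]

theorem oplus_add (X Y Z : R) : oplus Y Z + X = oplus (Y + X) (Z + X) := by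
  rw [add_comm, add_oplus, add_comm X Y, add_comm X Z]

/-- The law `⊕` on the group of differences of `R`:
`(A - B) ⊕ (C - D) = ((A + D) ⊕ (C + B)) - (B + D)`. -/
def fracOplus (x y : GrothendieckAddGroup R) : GrothendieckAddGroup R :=
  AddLocalization.liftOn₂ x y
    (fun A B C D => AddLocalization.mk (oplus (A + D) (C + B)) (B + D)) (by
      intro a a' b b' c c' d d' h₁ h₂
      rw [AddLocalization.r_iff_exists] at h₁ h₂
      obtain ⟨e, he⟩ := h₁
      obtain ⟨k, hk⟩ := h₂
      rw [AddLocalization.mk_eq_mk_iff, AddLocalization.r_iff_exists]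
      refine ⟨e + k, ?_⟩
      simp only [AddSubmonoid.coe_add, add_oplus] at he hk ⊢
      congr 1
      · calc _ = ((e : R) + (b' + a)) + (k + d' + d) := by abel
          _ = _ := by rw [he]; abel
      · calc _ = ((k : R) + (d' + c)) + (e + b' + b) := by abel
          _ = _ := by rw [hk]; abel)

/-- The semi-field of fractions of `R`: the group `{X - Y | X, Y ∈ R}` of differences of `(R, +)`
with the law `fracOplus`. -/
instance : CharOneSemiring (GrothendieckAddGroup R) where
  oplus := fracOplus
  oplus_assoc x y z := by
    induction x using AddLocalization.ind with | _ x
    induction y using AddLocalization.ind with | _ y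
    induction z using AddLocalization.ind with | _ z
    obtain ⟨a, b⟩ := x
    obtain ⟨c, d⟩ := y
    obtain ⟨u, v⟩ := z
    simp only [fracOplus, AddLocalization.liftOn₂_mk, AddSubmonoid.coe_add, oplus_add, oplus_assoc]
    congr 1
    · congr 1
      · abel
      · congr 1 <;> abel
    · abel
  oplus_comm x y := by
    induction x using AddLocalization.ind with | _ x
    induction y using AddLocalization.ind with | _ y
    obtain ⟨a, b⟩ := x
    obtain ⟨c, d⟩ := y
    simp only [fracOplus, AddLocalization.liftOn₂_mk]
    rw [oplus_comm, add_comm b d]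
  oplus_idem x := by
    induction x using AddLocalization.ind with | _ x
    obtain ⟨a, b⟩ := x
    simp only [fracOplus, AddLocalization.liftOn₂_mk, oplus_idem]
    rw [AddLocalization.mk_eq_mk_iff, AddLocalization.r_iff_exists]
    exact ⟨0, by simp only [AddSubmonoid.coe_add]; abel⟩
  add_oplus x y z := by
    induction x using AddLocalization.ind with | _ x
    induction y using AddLocalization.ind with | _ y
    induction z using AddLocalization.ind with | _ z
    obtain ⟨a, b⟩ := x
    obtain ⟨c, d⟩ := y
    obtain ⟨u, v⟩ := z
    simp only [fracOplus, AddLocalization.liftOn₂_mk, AddLocalization.mk_add]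
    rw [AddLocalization.mk_eq_mk_iff, AddLocalization.r_iff_exists]
    refine ⟨0, ?_⟩
    simp only [AddSubmonoid.coe_add, add_oplus]
    congr 1 <;> abel

end Fractions

section Spectrum

variable {R : Type*} [AddCommMonoid R] [CharOneSemiring R]

/-- The action `t X = θ_a (θ_b⁻¹ X)` of a rational number `t = a / b ≥ 0` (in lowest terms) on a
perfect semi-ring, where `θ_n X = n X`; in particular `0 X = 0`. -/
noncomputable def ratSmul [IsPerfect R] (t : ℚ≥0) (X : R) : R :=
  t.num • Function.surjInv (IsPerfect.surjective_nsmul (R := R) t.den t.den_pos) X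

/-- `-t E ≤ Z ≤ t E` in the semi-field of fractions of `R`. -/
def AbsLe [IsPerfect R] (E : R) (t : ℚ≥0) (Z : GrothendieckAddGroup R) : Prop :=
  Le (-GrothendieckAddGroup.of (ratSmul t E)) Z ∧ Le Z (GrothendieckAddGroup.of (ratSmul t E))

/-- `E` absorbs every element of `R`: for all `X ∈ R` there is a rational `t ≥ 0` such that
`-t E ≤ X ≤ t E`. -/
def IsOrderUnit [IsPerfect R] (E : R) : Prop :=
  ∀ X : R, ∃ t : ℚ≥0, AbsLe E t (GrothendieckAddGroup.of X)

/-- `r(Z) = inf {t ∈ ℚ, t ≥ 0 | -t E ≤ Z ≤ t E}`, a real number. -/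
noncomputable def gauge [IsPerfect R] (E : R) (Z : GrothendieckAddGroup R) : ℝ :=
  sInf {s : ℝ | ∃ t : ℚ≥0, s = (t : ℝ) ∧ AbsLe E t Z}

/-- `r(X - Y) = 0` implies `X = Y`, for all `X, Y ∈ R`. -/
def GaugeSeparates [IsPerfect R] (E : R) : Prop :=
  ∀ X Y : R,
    gauge E (GrothendieckAddGroup.of X - GrothendieckAddGroup.of Y) = 0 → X = Y

/-- The spectrum `S_E(R)`: the characters `φ : (R, ⊕, +) → (ℝ, max, +)` with `φ E = 1`. -/
def Spectrum (E : R) : Type _ := {φ : Hom R ℝ // φ E = 1}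

/-- The weakest topology on `S_E(R)` for which all the maps `φ ↦ φ X` are continuous. -/
instance (E : R) : TopologicalSpace (Spectrum E) :=
  ⨅ X : R, TopologicalSpace.induced (fun φ : Spectrum E => φ.1 X) inferInstance

end Spectrum

end CharOneSemiring

/-! Continuity of each `j X` is built into the topology, so the content is that characters separate
points. The fractions form an abelian group with translation-invariant joins, in which `E` becomes
an order unit `e`. Such a group is unperforated, so the upper gauge `unitSup e` is subadditive,
homogeneous and turns joins into maxima. A Hahn-Banach argument inside this class of functionals
(`exists_addMonoidHom_le`) lowers the gauge to pin its value at `-y`, then takes a minimal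
functional by Zorn; minimality forces additivity. Hence `unitSup e y` is the value at `y` of a
normalized character (`exists_character_eq_unitSup`). If all characters agree at `X` and `Y`, the
upper gauges of `X - Y` and `Y - X` are both nonpositive, so `r(X - Y) = 0` and `X = Y`. -/

section LatticeOrderedGroup

variable {G : Type*} [AddCommGroup G] [SemilatticeSup G]

/-! ### Unperforatedness of groups with translation-invariant joins. -/

theorem sup_add_distrib [IsOrderedAddMonoid G] (a b c : G) : (a ⊔ b) + c = (a + c) ⊔ (b + c) :=
  (OrderIso.addRight c).map_sup a b

/-- The witness is `w = 0 ⊔ x ⊔ ... ⊔ k • x`: translating by `x` only adds the term `(k + 1) • x`.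
If that term is nonpositive, then `w + x ≤ w` and `w` cancels. -/
theorem exists_add_le_sup_succ_nsmul [IsOrderedAddMonoid G] (x : G) (k : ℕ) :
    ∃ w : G, 0 ≤ w ∧ w + x ≤ w ⊔ (k + 1) • x := by
  induction k with
  | zero => exact ⟨0, le_rfl, by simp⟩
  | succ k ih =>
    obtain ⟨w, hw, hwx⟩ := ih
    refine ⟨(w + x) ⊔ 0, le_sup_right, ?_⟩
    rw [sup_add_distrib]
    refine sup_le ?_ ?_
    · refine (add_le_add_left hwx x).trans ?_
      rw [sup_add_distrib, ← succ_nsmul]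
      exact sup_le_sup le_sup_left le_rfl
    · exact (add_le_add_left hw x).trans (le_sup_left.trans le_sup_left)

/-- A lattice-ordered abelian group is unperforated. -/
theorem nonpos_of_nsmul_nonpos [IsOrderedAddMonoid G]
    {n : ℕ} (hn : 0 < n) {x : G} (h : n • x ≤ 0) : x ≤ 0 := by
  obtain ⟨k, rfl⟩ := Nat.exists_eq_succ_of_ne_zero hn.ne'
  obtain ⟨w, hw, hwx⟩ := exists_add_le_sup_succ_nsmul x k
  have : w + x ≤ w + 0 := by
    rw [add_zero]
    exact hwx.trans (sup_le le_rfl (h.trans hw))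
  exact le_of_add_le_add_left this

theorem le_of_nsmul_le_nsmul [IsOrderedAddMonoid G]
    {n : ℕ} (hn : 0 < n) {x y : G} (h : n • x ≤ n • y) : x ≤ y := by
  rw [← sub_nonpos] at h ⊢
  exact nonpos_of_nsmul_nonpos hn (by rwa [nsmul_sub])

/-- `n • (x ⊔ y)` is the join of the `i • x + j • y` with `i + j = n`, each at most `z` by
unperforatedness. The induction expands the `k` remaining copies of `x ⊔ y` one at a time. -/
theorem nsmul_sup_le [IsOrderedAddMonoid G]
    {n : ℕ} (hn : 0 < n) {x y z : G} (hx : n • x ≤ z) (hy : n • y ≤ z) :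
    n • (x ⊔ y) ≤ z := by
  have key : ∀ k i j : ℕ, i + j + k = n → i • x + j • y + k • (x ⊔ y) ≤ z := by
    intro k
    induction k with
    | zero =>
      intro i j hij
      apply le_of_nsmul_le_nsmul hn
      calc n • (i • x + j • y + 0 • (x ⊔ y)) = i • (n • x) + j • (n • y) := by
            rw [zero_nsmul, add_zero, nsmul_add, smul_comm n i, smul_comm n j]
        _ ≤ i • z + j • z := add_le_add (nsmul_le_nsmul_right hx i) (nsmul_le_nsmul_right hy j)
        _ = n • z := by rw [← add_nsmul, ← hij, add_zero]
    | succ k ih =>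
      intro i j hij
      have h₁ := ih (i + 1) j (by omega)
      have h₂ := ih i (j + 1) (by omega)
      calc i • x + j • y + (k + 1) • (x ⊔ y)
          = (x ⊔ y) + (i • x + j • y + k • (x ⊔ y)) := by rw [succ_nsmul]; abel
        _ = _ := sup_add_distrib _ _ _
        _ ≤ z := sup_le
            (le_of_eq_of_le (by rw [succ_nsmul]; abel) h₁)
            (le_of_eq_of_le (by rw [succ_nsmul]; abel) h₂)
  simpa using key n 0 0 (by omega)

/-! ### Hahn-Banach for join-preserving sublinear functionals. -/

/-- Real functionals which are subadditive, positively homogeneous and compatible with joins. -/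
structure IsTropicalSublinear (p : G → ℝ) : Prop where
  add_le : ∀ x y, p (x + y) ≤ p x + p y
  map_nsmul : ∀ (n : ℕ) x, p (n • x) = n * p x
  map_sup : ∀ x y, p (x ⊔ y) = max (p x) (p y)

namespace IsTropicalSublinear

variable {p : G → ℝ}

theorem map_zero (hp : IsTropicalSublinear p) : p 0 = 0 := by
  simpa using hp.map_nsmul 0 0

theorem neg_map_neg_le (hp : IsTropicalSublinear p) (x : G) : -p (-x) ≤ p x := by
  have := hp.add_le x (-x)
  rw [add_neg_cancel, hp.map_zero] at this
  linarith

/-- The infimum of a nonempty chain of tropically sublinear functionals bounded below. -/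
theorem iInf_chain (c : Set (G → ℝ)) (hc : IsChain (· ≤ ·) c) (hne : c.Nonempty)
    (hcs : ∀ f ∈ c, IsTropicalSublinear f) (hb : ∀ x, BddBelow (Set.range fun f : c => f.1 x)) :
    IsTropicalSublinear fun x => ⨅ f : c, f.1 x := by
  have : Nonempty c := hne.to_subtype
  -- Directedness of the chain lets a single functional serve two arguments, so sums and joins
  -- survive the infimum.
  have lower : ∀ f g : c, ∃ h : c, h.1 ≤ f.1 ∧ h.1 ≤ g.1 := fun f g =>
    (hc.total f.2 g.2).elim (fun h => ⟨f, le_rfl, h⟩) (fun h => ⟨g, h, le_rfl⟩)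
  refine ⟨fun x y => ?_, fun n x => ?_, fun x y => le_antisymm ?_ ?_⟩
  · refine le_ciInf_add_ciInf fun f g => ?_
    obtain ⟨h, hf, hg⟩ := lower f g
    exact (ciInf_le (hb _) h).trans (((hcs _ h.2).add_le x y).trans (add_le_add (hf x) (hg y)))
  · simp only [fun f : c => (hcs _ f.2).map_nsmul n x]
    exact (Real.mul_iInf_of_nonneg n.cast_nonneg _).symm
  · refine le_of_forall_gt fun r hr => ?_
    obtain ⟨h₁, h₂⟩ := max_lt_iff.1 hr
    obtain ⟨f, hf⟩ := exists_lt_of_ciInf_lt h₁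
    obtain ⟨g, hg⟩ := exists_lt_of_ciInf_lt h₂
    obtain ⟨h, hhf, hhg⟩ := lower f g
    refine (ciInf_le (hb _) h).trans_lt ?_
    rw [(hcs _ h.2).map_sup]
    exact max_lt ((hhf x).trans_lt hf) ((hhg y).trans_lt hg)
  · refine le_ciInf fun f => ?_
    rw [(hcs _ f.2).map_sup]
    exact max_le_max (ciInf_le (hb _) f) (ciInf_le (hb _) f)

/-- Below a tropically sublinear functional there is a minimal one. -/
theorem exists_minimal (hp : IsTropicalSublinear p) :
    ∃ q ≤ p, IsTropicalSublinear q ∧ ∀ q' ≤ q, IsTropicalSublinear q' → q ≤ q' := by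
  obtain ⟨q, hqp, hq, hmin⟩ := @zorn_le_nonempty₀ (G → ℝ)ᵒᵈ _
    {q : G → ℝ | IsTropicalSublinear q ∧ q ≤ p} (fun c hcs hc f hf => by
      have hb : ∀ x, BddBelow (Set.range fun f : c => (f.1 : G → ℝ) x) := fun x => by
        -- Every `g ≤ p` in the class satisfies `-p (-x) ≤ -g (-x) ≤ g x`.
        refine ⟨-p (-x), ?_⟩
        rintro _ ⟨g, rfl⟩
        exact (neg_le_neg ((hcs g.2).2 (-x))).trans ((hcs g.2).1.neg_map_neg_le x)
      exact ⟨_, ⟨iInf_chain c hc.symm ⟨f, hf⟩ (fun g hg => (hcs hg).1) hb,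
        fun x => (ciInf_le (hb x) ⟨f, hf⟩).trans ((hcs hf).2 x)⟩,
        fun g hg x => ciInf_le (hb x) ⟨g, hg⟩⟩) p ⟨hp, le_refl p⟩
  exact ⟨q, hq.2, hq.1, fun q' hq' h => hmin ⟨h, hq'.trans hq.2⟩ hq'⟩

/-- The infimum of `p (x + n y) - n p y` over natural numbers `n`: the largest functional below `p`
which takes the value `-p y` at `-y`. -/
noncomputable def lowerAt (p : G → ℝ) (y x : G) : ℝ := ⨅ n : ℕ, (p (x + n • y) - n * p y)

theorem bddBelow_lowerAt (hp : IsTropicalSublinear p) (y x : G) :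
    BddBelow (Set.range fun n : ℕ => p (x + n • y) - n * p y) := by
  refine ⟨-p (-x), ?_⟩
  rintro _ ⟨n, rfl⟩
  have := hp.add_le (x + n • y) (-x)
  rw [add_neg_cancel_comm, hp.map_nsmul] at this
  dsimp only
  linarith

theorem lowerAt_le_apply (hp : IsTropicalSublinear p) (y x : G) (n : ℕ) :
    lowerAt p y x ≤ p (x + n • y) - n * p y :=
  ciInf_le (hp.bddBelow_lowerAt y x) n

/-- The infimum is thus a decreasing limit: two arguments may share a large index, and indices may
be restricted to multiples of `k`. -/
theorem antitone_lowerAt (hp : IsTropicalSublinear p) (y x : G) :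
    Antitone fun n : ℕ => p (x + n • y) - n * p y := by
  refine antitone_nat_of_succ_le fun n => ?_
  have := hp.add_le (x + n • y) y
  rw [add_assoc, ← succ_nsmul] at this
  push_cast
  linarith

theorem lowerAt_isTropicalSublinear [IsOrderedAddMonoid G] (hp : IsTropicalSublinear p) (y : G) :
    IsTropicalSublinear (lowerAt p y) := by
  refine ⟨fun x x' => ?_, fun k x => ?_, fun x x' => le_antisymm ?_ ?_⟩
  · refine le_ciInf_add_ciInf fun n m => (hp.lowerAt_le_apply y _ (n + m)).trans ?_
    have := hp.add_le (x + n • y) (x' + m • y)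
    rw [add_add_add_comm, ← add_nsmul] at this
    push_cast
    linarith
  · rcases Nat.eq_zero_or_pos k with rfl | hk
    · simp [lowerAt, hp.map_nsmul]
    have scale : ∀ n : ℕ, p (k • x + (k * n) • y) - (k * n : ℕ) * p y
        = k * (p (x + n • y) - n * p y) := fun n => by
      rw [mul_nsmul', ← nsmul_add, hp.map_nsmul]
      push_cast
      ring
    have hmul : k * lowerAt p y x = ⨅ n : ℕ, k * (p (x + n • y) - n * p y) :=
      Real.mul_iInf_of_nonneg k.cast_nonneg _
    rw [hmul]
    refine le_antisymm (le_ciInf fun n => ?_) (le_ciInf fun n => ?_)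
    · rw [← scale]
      exact hp.lowerAt_le_apply y _ _
    · rw [← hmul]
      calc k * lowerAt p y x ≤ k * (p (x + n • y) - n * p y) :=
            mul_le_mul_of_nonneg_left (hp.lowerAt_le_apply y x n) k.cast_nonneg
        _ = _ := (scale n).symm
        _ ≤ _ := hp.antitone_lowerAt y (k • x) (Nat.le_mul_of_pos_left n hk)
  · refine le_of_forall_gt fun r hr => ?_
    obtain ⟨h₁, h₂⟩ := max_lt_iff.1 hr
    obtain ⟨n, hn⟩ := exists_lt_of_ciInf_lt h₁
    obtain ⟨m, hm⟩ := exists_lt_of_ciInf_lt h₂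
    refine (hp.lowerAt_le_apply y _ (max n m)).trans_lt ?_
    rw [sup_add_distrib, hp.map_sup, ← max_sub_sub_right]
    exact max_lt ((hp.antitone_lowerAt y x (le_max_left n m)).trans_lt hn)
      ((hp.antitone_lowerAt y x' (le_max_right n m)).trans_lt hm)
  · refine le_ciInf fun n => ?_
    rw [sup_add_distrib, hp.map_sup, ← max_sub_sub_right]
    exact max_le_max (hp.lowerAt_le_apply y x n) (hp.lowerAt_le_apply y x' n)

theorem lowerAt_le (hp : IsTropicalSublinear p) (y : G) : lowerAt p y ≤ p := fun x => by
  simpa using hp.lowerAt_le_apply y x 0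

/-- A tropically sublinear functional dominates an additive join-preserving functional which agrees
with it at a given point. -/
theorem exists_addMonoidHom_le [IsOrderedAddMonoid G] (hp : IsTropicalSublinear p) (y : G) :
    ∃ φ : G →+ ℝ, (∀ x x', φ (x ⊔ x') = max (φ x) (φ x')) ∧ (∀ x, φ x ≤ p x) ∧ φ y = p y := by
  obtain ⟨q, hqp, hq, hmin⟩ := (hp.lowerAt_isTropicalSublinear y).exists_minimal
  -- Minimality gives `q ≤ lowerAt q z`; the term of index `1` then yields `q x ≤ q (x + z) - q z`.
  have hadd : ∀ x z, q (x + z) = q x + q z := fun x z => by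
    refine le_antisymm (hq.add_le x z) ?_
    have h := (hmin _ (hq.lowerAt_le z) (hq.lowerAt_isTropicalSublinear z) x).trans
      (hq.lowerAt_le_apply z x 1)
    rw [one_nsmul, Nat.cast_one, one_mul] at h
    linarith
  let φ : G →+ ℝ := ⟨⟨q, hq.map_zero⟩, hadd⟩
  have hle : ∀ x, φ x ≤ p x := fun x => (hqp x).trans (hp.lowerAt_le y x)
  refine ⟨φ, hq.map_sup, hle, le_antisymm (hle y) ?_⟩
  have h : φ (-y) ≤ _ := (hqp (-y)).trans (hp.lowerAt_le_apply y (-y) 1)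
  rw [one_nsmul, neg_add_cancel, hp.map_zero, Nat.cast_one, one_mul, map_neg] at h
  linarith

end IsTropicalSublinear

/-! ### The upper gauge of an order unit. -/

/-- The real numbers `r` bounding `x` relatively to `e`, i.e. `n x ≤ m e` for some `m / n ≤ r`. -/
def unitBounds (e x : G) : Set ℝ :=
  {r | ∃ (n : ℕ) (m : ℤ), 0 < n ∧ n • x ≤ m • e ∧ (m : ℝ) ≤ n * r}

/-- The infimum of the rational numbers `t` with `x ≤ t e`. -/
noncomputable def unitSup (e x : G) : ℝ := sInf (unitBounds e x)

theorem mem_unitBounds_of_le {e x : G} {r s : ℝ} (hr : r ∈ unitBounds e x) (h : r ≤ s) :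
    s ∈ unitBounds e x := by
  obtain ⟨n, m, hn, hx, hm⟩ := hr
  exact ⟨n, m, hn, hx, hm.trans (mul_le_mul_of_nonneg_left h n.cast_nonneg)⟩

theorem intCast_mem_unitBounds {e x : G} {m : ℤ} (h : x ≤ m • e) : (m : ℝ) ∈ unitBounds e x :=
  ⟨1, m, one_pos, by rwa [one_nsmul], by simp⟩

theorem mem_unitBounds_of_nsmul_le {e x y : G} {r : ℝ} (h : ∀ n : ℕ, n • x ≤ n • y)
    (hr : r ∈ unitBounds e y) : r ∈ unitBounds e x := by
  obtain ⟨n, m, hn, hy, hm⟩ := hr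
  exact ⟨n, m, hn, (h n).trans hy, hm⟩

/-- This is where `e ≠ 0` enters; it keeps `unitBounds e x` bounded below. -/
theorem zsmul_le_zsmul_iff_of_pos [IsOrderedAddMonoid G]
    {e : G} (he : 0 ≤ e) (he₀ : e ≠ 0) {m m' : ℤ} :
    m • e ≤ m' • e ↔ m ≤ m' := by
  refine ⟨fun h => ?_, fun h => zsmul_le_zsmul_left he h⟩
  by_contra! hlt
  obtain ⟨k, hk⟩ := Int.eq_ofNat_of_zero_le (sub_nonneg.2 hlt.le)
  refine he₀ (le_antisymm (nonpos_of_nsmul_nonpos (n := k) (by omega) ?_) he)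
  rw [← natCast_zsmul, ← hk, sub_smul]
  exact sub_nonpos.2 h

theorem neg_mem_lowerBounds_unitBounds [IsOrderedAddMonoid G]
    {e : G} (he : 0 ≤ e) (he₀ : e ≠ 0) {x : G} {N : ℕ}
    (hN : -x ≤ N • e) : -(N : ℝ) ∈ lowerBounds (unitBounds e x) := by
  rintro r ⟨n, m, hn, hx, hr⟩
  have h : (-(n * N : ℕ) : ℤ) • e ≤ m • e := by
    refine le_trans ?_ hx
    rw [neg_zsmul, natCast_zsmul, mul_nsmul', neg_le, ← smul_neg]
    exact nsmul_le_nsmul_right hN n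
  rw [zsmul_le_zsmul_iff_of_pos he he₀] at h
  have hn' : (0 : ℝ) < n := by exact_mod_cast hn
  have h' : -((n : ℝ) * N) ≤ m := by exact_mod_cast h
  refine le_of_mul_le_mul_left ?_ hn'
  linarith

theorem mul_nsmul_le_mul_zsmul [IsOrderedAddMonoid G]
    {e x : G} {n : ℕ} {m : ℤ} (h : n • x ≤ m • e) (k : ℕ) :
    (k * n) • x ≤ ((k : ℤ) * m) • e := by
  rw [mul_smul, mul_smul, natCast_zsmul]
  exact nsmul_le_nsmul_right h k

theorem add_mem_unitBounds [IsOrderedAddMonoid G] {e x y : G} {r s : ℝ} (hr : r ∈ unitBounds e x)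
    (hs : s ∈ unitBounds e y) : r + s ∈ unitBounds e (x + y) := by
  obtain ⟨n, m, hn, hx, hm⟩ := hr
  obtain ⟨n', m', hn', hy, hm'⟩ := hs
  refine ⟨n' * n, n' * m + n * m', Nat.mul_pos hn' hn, ?_, ?_⟩
  · rw [nsmul_add, add_smul]
    refine add_le_add (mul_nsmul_le_mul_zsmul hx n') ?_
    rw [mul_comm n' n]
    exact mul_nsmul_le_mul_zsmul hy n
  · push_cast
    have h₁ := mul_le_mul_of_nonneg_left hm (n'.cast_nonneg (α := ℝ))
    have h₂ := mul_le_mul_of_nonneg_left hm' (n.cast_nonneg (α := ℝ))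
    linarith

/-- Over a common denominator, `0 ≤ e` allows both numerators to be raised to the larger one, and
`nsmul_sup_le` applies. -/
theorem sup_mem_unitBounds [IsOrderedAddMonoid G]
    {e x y : G} (he : 0 ≤ e) {r : ℝ} (hx : r ∈ unitBounds e x)
    (hy : r ∈ unitBounds e y) : r ∈ unitBounds e (x ⊔ y) := by
  obtain ⟨n, m, hn, hx, hm⟩ := hx
  obtain ⟨n', m', hn', hy, hm'⟩ := hy
  refine ⟨n' * n, max (n' * m) (n * m'), Nat.mul_pos hn' hn,
    nsmul_sup_le (Nat.mul_pos hn' hn) ?_ ?_, ?_⟩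
  · exact (mul_nsmul_le_mul_zsmul hx n').trans (zsmul_le_zsmul_left he (le_max_left _ _))
  · rw [mul_comm n' n]
    exact (mul_nsmul_le_mul_zsmul hy n).trans (zsmul_le_zsmul_left he (le_max_right _ _))
  · have h₁ := mul_le_mul_of_nonneg_left hm (n'.cast_nonneg (α := ℝ))
    have h₂ := mul_le_mul_of_nonneg_left hm' (n.cast_nonneg (α := ℝ))
    push_cast
    exact max_le (by linarith) (by linarith)

theorem nsmul_mem_unitBounds_iff [IsOrderedAddMonoid G] {e x : G} {k : ℕ} (hk : 0 < k) {r : ℝ} :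
    k * r ∈ unitBounds e (k • x) ↔ r ∈ unitBounds e x := by
  constructor
  · rintro ⟨n, m, hn, hx, hm⟩
    refine ⟨n * k, m, Nat.mul_pos hn hk, by rwa [mul_smul], ?_⟩
    push_cast
    linarith
  · rintro ⟨n, m, hn, hx, hm⟩
    refine ⟨n, k * m, hn, ?_, ?_⟩
    · rw [← mul_smul, mul_comm n k]
      exact mul_nsmul_le_mul_zsmul hx k
    · have h := mul_le_mul_of_nonneg_left hm (k.cast_nonneg (α := ℝ))
      push_cast
      linarith

variable {e : G}

theorem unitBounds_nonempty (hu : ∀ x : G, ∃ N : ℕ, x ≤ N • e) (x : G) :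
    (unitBounds e x).Nonempty := by
  obtain ⟨N, hN⟩ := hu x
  exact ⟨_, intCast_mem_unitBounds (m := N) (by rwa [natCast_zsmul])⟩

theorem bddBelow_unitBounds [IsOrderedAddMonoid G]
    (he : 0 ≤ e) (he₀ : e ≠ 0) (hu : ∀ x : G, ∃ N : ℕ, x ≤ N • e) (x : G) :
    BddBelow (unitBounds e x) := by
  obtain ⟨N, hN⟩ := hu (-x)
  exact ⟨_, neg_mem_lowerBounds_unitBounds he he₀ hN⟩

theorem mem_unitBounds_of_unitSup_lt (hu : ∀ x : G, ∃ N : ℕ, x ≤ N • e) {x : G} {r : ℝ}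
    (h : unitSup e x < r) : r ∈ unitBounds e x := by
  obtain ⟨s, hs, hsr⟩ := exists_lt_of_csInf_lt (unitBounds_nonempty hu x) h
  exact mem_unitBounds_of_le hs hsr.le

theorem unitSup_isTropicalSublinear [IsOrderedAddMonoid G] (he : 0 ≤ e) (he₀ : e ≠ 0)
    (hu : ∀ x : G, ∃ N : ℕ, x ≤ N • e) : IsTropicalSublinear (unitSup e) := by
  have hb := bddBelow_unitBounds he he₀ hu
  have mono : ∀ {x y : G}, x ≤ y → unitSup e x ≤ unitSup e y := fun {x y} h =>
    le_csInf (unitBounds_nonempty hu y) fun r hr =>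
      csInf_le (hb x) (mem_unitBounds_of_nsmul_le (fun n => nsmul_le_nsmul_right h n) hr)
  refine ⟨fun x y => ?_, fun k x => ?_, fun x y => le_antisymm ?_ ?_⟩
  · refine le_of_forall_pos_le_add fun ε hε => ?_
    have hx := mem_unitBounds_of_unitSup_lt hu (lt_add_of_pos_right (unitSup e x) (half_pos hε))
    have hy := mem_unitBounds_of_unitSup_lt hu (lt_add_of_pos_right (unitSup e y) (half_pos hε))
    have : unitSup e (x + y) ≤ _ := csInf_le (hb _) (add_mem_unitBounds hx hy)
    linarith
  · rcases Nat.eq_zero_or_pos k with rfl | hk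
    · rw [zero_nsmul, Nat.cast_zero, zero_mul]
      refine le_antisymm (csInf_le (hb _) ?_) (le_csInf (unitBounds_nonempty hu _) ?_)
      · simpa using intCast_mem_unitBounds (e := e) (x := 0) (m := 0) (by simp)
      · intro r hr
        simpa using neg_mem_lowerBounds_unitBounds he he₀ (x := 0) (N := 0) (by simp) hr
    · have hk' : (0 : ℝ) < k := by exact_mod_cast hk
      refine le_antisymm ?_ (le_csInf (unitBounds_nonempty hu _) fun r hr => ?_)
      · rw [← div_le_iff₀' hk']
        refine le_csInf (unitBounds_nonempty hu x) fun r hr => ?_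
        rw [div_le_iff₀' hk']
        exact csInf_le (hb _) ((nsmul_mem_unitBounds_iff hk).2 hr)
      · rw [← le_div_iff₀' hk']
        refine csInf_le (hb _) ((nsmul_mem_unitBounds_iff hk).1 ?_)
        rwa [mul_div_cancel₀ _ hk'.ne']
  · refine le_of_forall_gt_imp_ge_of_dense fun r hr => ?_
    obtain ⟨h₁, h₂⟩ := max_lt_iff.1 hr
    exact csInf_le (hb _) (sup_mem_unitBounds he (mem_unitBounds_of_unitSup_lt hu h₁)
      (mem_unitBounds_of_unitSup_lt hu h₂))
  · exact max_le (mono le_sup_left) (mono le_sup_right)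

/-- In a lattice-ordered abelian group with order unit `e`, the upper gauge of each element is
attained by a real lattice character normalized at `e`. -/
theorem exists_character_eq_unitSup [IsOrderedAddMonoid G] (he : 0 ≤ e) (he₀ : e ≠ 0)
    (hu : ∀ x : G, ∃ N : ℕ, x ≤ N • e) (y : G) :
    ∃ φ : G →+ ℝ, (∀ x x', φ (x ⊔ x') = max (φ x) (φ x')) ∧ φ e = 1 ∧ φ y = unitSup e y := by
  obtain ⟨φ, hsup, hle, hy⟩ :=
    (unitSup_isTropicalSublinear he he₀ hu).exists_addMonoidHom_le y
  have hb := bddBelow_unitBounds he he₀ hu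
  -- Bounding both `e` and `-e` forces `φ e = 1`; the second bound needs negative numerators.
  have h₁ : unitSup e e ≤ ((1 : ℤ) : ℝ) := csInf_le (hb e) (intCast_mem_unitBounds (by simp))
  have h₂ : unitSup e (-e) ≤ ((-1 : ℤ) : ℝ) := csInf_le (hb (-e)) (intCast_mem_unitBounds (by simp))
  have h₃ := hle (-e)
  rw [map_neg] at h₃
  push_cast at h₁ h₂
  exact ⟨φ, hsup, le_antisymm ((hle e).trans h₁) (by linarith), hy⟩

end LatticeOrderedGroup

/-! ### Application to the semi-field of fractions and the spectrum. -/

namespace CharOneSemiring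

open Algebra

variable {R : Type*} [AddCommMonoid R] [CharOneSemiring R]

/-- The join-semilattice underlying the semi-field of fractions. -/
abbrev fracSemilatticeSup : SemilatticeSup (GrothendieckAddGroup R) :=
  letI : Max (GrothendieckAddGroup R) := ⟨oplus⟩
  SemilatticeSup.mk' oplus_comm oplus_assoc oplus_idem

attribute [local instance] fracSemilatticeSup

theorem frac_isOrderedAddMonoid : IsOrderedAddMonoid (GrothendieckAddGroup R) where
  add_le_add_left a b h c := by
    change oplus (a + c) (b + c) = b + c
    rw [← oplus_add, show oplus a b = b from h]

attribute [local instance] frac_isOrderedAddMonoid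

theorem of_oplus (X Y : R) : GrothendieckAddGroup.of (oplus X Y)
    = GrothendieckAddGroup.of X ⊔ GrothendieckAddGroup.of Y := by
  change AddLocalization.mk (oplus X Y) 0
    = fracOplus (AddLocalization.mk X 0) (AddLocalization.mk Y 0)
  simp [fracOplus, AddLocalization.liftOn₂_mk]

theorem continuous_spectrum_apply (E X : R) : Continuous fun φ : Spectrum E => φ.1 X :=
  continuous_iInf_dom (i := X) continuous_induced_dom

/-- Evaluation of the elements of `R` on the spectrum. -/
def evalHom (E : R) : Hom R C(Spectrum E, ℝ) where
  toFun X := ⟨fun φ => φ.1 X, continuous_spectrum_apply E X⟩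
  map_zero' := ContinuousMap.ext fun φ => φ.1.map_zero'
  map_add' X Y := ContinuousMap.ext fun φ => φ.1.map_add' X Y
  map_oplus X Y := ContinuousMap.ext fun φ => φ.1.map_oplus X Y

variable [IsPerfect R]

theorem den_nsmul_ratSmul {S : Type*} [AddCommMonoid S] [IsPerfect S] (t : ℚ≥0) (X : S) :
    t.den • ratSmul t X = t.num • X := by
  rw [ratSmul, smul_comm]
  congr 1
  exact Function.surjInv_eq (IsPerfect.surjective_nsmul (R := S) t.den t.den_pos) X

/-- Unperforatedness replaces division by integer multiples, so the root chosen in `ratSmul` is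
immaterial. -/
theorem le_of_ratSmul_iff (t : ℚ≥0) (E : R) (Z : GrothendieckAddGroup R) :
    Z ≤ GrothendieckAddGroup.of (ratSmul t E) ↔
      t.den • Z ≤ t.num • GrothendieckAddGroup.of E := by
  rw [← map_nsmul, ← den_nsmul_ratSmul, map_nsmul]
  exact ⟨fun h => nsmul_le_nsmul_right h _, le_of_nsmul_le_nsmul t.den_pos⟩

theorem absLe_iff (E : R) (t : ℚ≥0) (Z : GrothendieckAddGroup R) :
    AbsLe E t Z ↔ t.den • (-Z) ≤ t.num • GrothendieckAddGroup.of E ∧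
      t.den • Z ≤ t.num • GrothendieckAddGroup.of E := by
  rw [← le_of_ratSmul_iff, ← le_of_ratSmul_iff, neg_le]
  rfl

theorem IsOrderUnit.of_nonneg {E : R} (hE : IsOrderUnit E) : 0 ≤ GrothendieckAddGroup.of E := by
  obtain ⟨t, ht⟩ := hE E
  have h := ((absLe_iff _ _ _).1 ht).1
  rw [smul_neg, neg_le_iff_add_nonneg, ← add_smul] at h
  exact le_of_nsmul_le_nsmul (Nat.add_pos_right t.num t.den_pos) (by rwa [smul_zero])

theorem IsOrderUnit.exists_le_nsmul {E : R} (hE : IsOrderUnit E) (Z : GrothendieckAddGroup R) :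
    ∃ N : ℕ, Z ≤ N • GrothendieckAddGroup.of E := by
  -- As `0 ≤ E` and `d ≥ 1`, the denominator can be dropped: `d • W ≤ n • E ≤ (d * n) • E`.
  have shrink : ∀ {d n : ℕ} {W : GrothendieckAddGroup R}, 0 < d →
      d • W ≤ n • GrothendieckAddGroup.of E → W ≤ n • GrothendieckAddGroup.of E :=
    fun {d n W} hd h => le_of_nsmul_le_nsmul hd <| h.trans <| by
      rw [← mul_smul]
      exact nsmul_le_nsmul_left hE.of_nonneg (Nat.le_mul_of_pos_left n hd)
  induction Z using AddLocalization.ind with | _ z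
  obtain ⟨X, Y⟩ := z
  obtain ⟨s, hs⟩ := hE X
  obtain ⟨t, ht⟩ := hE Y
  have hX := shrink s.den_pos ((absLe_iff _ _ _).1 hs).2
  have hY := shrink t.den_pos ((absLe_iff _ _ _).1 ht).1
  refine ⟨s.num + t.num, ?_⟩
  have hXY : AddLocalization.mk X Y
      = GrothendieckAddGroup.of X + -GrothendieckAddGroup.of (Y : R) := by
    change _ = AddLocalization.mk X 0 + -AddLocalization.mk (Y : R) 0
    rw [GrothendieckAddGroup.neg_mk, AddLocalization.mk_add]
    simp
  rw [hXY, add_smul]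
  exact add_le_add hX hY

theorem nsmul_le_of_mem_unitBounds {E : R} (hE : IsOrderUnit E) {Z : GrothendieckAddGroup R}
    {t : ℚ≥0} (h : (t : ℝ) ∈ unitBounds (GrothendieckAddGroup.of E) Z) :
    t.den • Z ≤ t.num • GrothendieckAddGroup.of E := by
  obtain ⟨n, m, hn, hZ, hm⟩ := h
  have hd : (0 : ℝ) < t.den := by exact_mod_cast t.den_pos
  have ht : (t : ℝ) = t.num / t.den := by
    rw [← NNRat.cast_def]
  have hmt : (t.den : ℤ) * m ≤ n * t.num := by
    rw [ht, mul_div_assoc', le_div_iff₀ hd] at hm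
    rw [mul_comm]
    exact_mod_cast hm
  refine le_of_nsmul_le_nsmul hn ?_
  rw [← mul_smul, ← mul_smul, mul_comm n]
  refine (mul_nsmul_le_mul_zsmul hZ t.den).trans ?_
  rw [← natCast_zsmul _ (n * t.num)]
  exact zsmul_le_zsmul_left hE.of_nonneg (by exact_mod_cast hmt)

theorem gauge_eq_zero_of_unitSup_nonpos {E : R} (hE : IsOrderUnit E) {Z : GrothendieckAddGroup R}
    (h₁ : unitSup (GrothendieckAddGroup.of E) Z ≤ 0)
    (h₂ : unitSup (GrothendieckAddGroup.of E) (-Z) ≤ 0) : gauge E Z = 0 := by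
  have hlb : (0 : ℝ) ∈ lowerBounds {s : ℝ | ∃ t : ℚ≥0, s = (t : ℝ) ∧ AbsLe E t Z} := by
    rintro _ ⟨t, rfl, -⟩
    exact t.cast_nonneg
  have hpos : ∀ t : ℚ≥0, 0 < t → AbsLe E t Z := fun t ht => by
    have ht' : (0 : ℝ) < t := by exact_mod_cast ht
    exact (absLe_iff _ _ _).2
      ⟨nsmul_le_of_mem_unitBounds hE
        (mem_unitBounds_of_unitSup_lt hE.exists_le_nsmul (h₂.trans_lt ht')),
      nsmul_le_of_mem_unitBounds hE
        (mem_unitBounds_of_unitSup_lt hE.exists_le_nsmul (h₁.trans_lt ht'))⟩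
  refine le_antisymm (le_of_forall_gt_imp_ge_of_dense fun r hr => ?_)
    (le_csInf ⟨_, 1, rfl, hpos 1 one_pos⟩ hlb)
  obtain ⟨q, hq₀, hqr⟩ := exists_rat_btwn hr
  have hq : 0 < q := by exact_mod_cast hq₀
  lift q to ℚ≥0 using hq.le
  exact (csInf_le ⟨0, hlb⟩ ⟨q, rfl, hpos q (by exact_mod_cast hq)⟩).trans
    (by exact_mod_cast hqr.le)

/-- A lattice character of the group of differences restricts to a point of the spectrum. -/
def Spectrum.ofCharacter {E : R} (φ : GrothendieckAddGroup R →+ ℝ)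
    (hφ : ∀ x x', φ (x ⊔ x') = max (φ x) (φ x')) (hE : φ (GrothendieckAddGroup.of E) = 1) :
    Spectrum E :=
  ⟨{ φ.comp GrothendieckAddGroup.of with
      map_oplus := fun X Y => (congrArg φ (of_oplus X Y)).trans (hφ _ _) }, hE⟩

theorem exists_spectrum_apply_ne [IsCancelAdd R] {E : R} (hE : IsOrderUnit E)
    (hr : GaugeSeparates E) {X Y : R} (hXY : X ≠ Y) : ∃ φ : Spectrum E, φ.1 X ≠ φ.1 Y := by
  -- If `E` vanished, the order unit property would collapse the whole group to zero.
  have he₀ : GrothendieckAddGroup.of E ≠ 0 := fun h₀ => by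
    refine hXY (GrothendieckAddGroup.of_injective ?_)
    have hz : ∀ Z : GrothendieckAddGroup R, Z ≤ 0 := fun Z => by
      obtain ⟨N, hN⟩ := hE.exists_le_nsmul Z
      rwa [h₀, smul_zero] at hN
    exact le_antisymm (sub_nonpos.1 (hz _)) (sub_nonpos.1 (hz _))
  have key : ∀ A B : R,
      0 < unitSup (GrothendieckAddGroup.of E) (GrothendieckAddGroup.of A - GrothendieckAddGroup.of B)
        → ∃ φ : Spectrum E, φ.1 A ≠ φ.1 B := fun A B hpos => by
    obtain ⟨φ, hsup, hφE, hφ⟩ := exists_character_eq_unitSup hE.of_nonneg he₀ hE.exists_le_nsmul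
      (GrothendieckAddGroup.of A - GrothendieckAddGroup.of B)
    rw [← hφ, map_sub, sub_pos] at hpos
    exact ⟨Spectrum.ofCharacter φ hsup hφE, hpos.ne'⟩
  by_contra! hall
  refine hXY (hr X Y (gauge_eq_zero_of_unitSup_nonpos hE ?_ ?_))
  · by_contra! hpos
    obtain ⟨φ, hφ⟩ := key X Y hpos
    exact hφ (hall φ)
  · by_contra! hpos
    rw [neg_sub] at hpos
    obtain ⟨φ, hφ⟩ := key Y X hpos
    exact hφ (hall φ).symm

end CharOneSemiring

theorem theorem6p1 {R : Type*} [AddCommMonoid R] [CharOneSemiring R] [IsCancelAdd R]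
    [CharOneSemiring.IsPerfect R] (E : R)
    (hE : CharOneSemiring.IsOrderUnit E) (hr : CharOneSemiring.GaugeSeparates E) :
    ∃ j : CharOneSemiring.Hom R C(CharOneSemiring.Spectrum E, ℝ),
      (∀ (X : R) (φ : CharOneSemiring.Spectrum E), j X φ = φ.1 X) ∧
        Function.Injective j := by
  refine ⟨CharOneSemiring.evalHom E, fun _ _ => rfl, fun X Y hXY => ?_⟩
  by_contra hne
  obtain ⟨φ, hφ⟩ := CharOneSemiring.exists_spectrum_apply_ne hE hr hne
  exact hφ (DFunLike.congr_fun hXY φ)
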